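/- Consider the stochastic system $x_{t+1}=f(x_t,u_t,w_t)$ with states $x_t\in\mathbb R^n$, controls $u_t$ in a convex (Borel) set $\mathbb U\subseteq\mathbb R^m$, and independent disturbances $w_t$ with given laws on $\mathbb W\subseteq\mathbb R^l$, where $f$ is measurable. Let $r:\mathbb R^n\times\mathbb R^m\to\mathbb R$ and $q:\mathbb R^n\to\mathbb R$ be measurable stage and terminal costs, $T\in\mathbb N$ a horizon, $A\subseteq\mathbb R^n$ a nonempty compact convex set, $\mathrm{dist}(x,A)=\inf_{y\in A}\|x-y\|$, $\alpha\in(0,1)$ and $\delta\ge 0$. For a random variable $X$ and a $\sigma$-algebra $\mathcal F$ let $$\mathrm{CVaR}_\alpha[X\mid\mathcal F]:=\operatorname*{ess\,inf}_{Z\in L^2(\mathcal F)}\Big(Z+\mathbb E\Big[\tfrac{(X-Z)^+}{1-\alpha}\,\Big|\,\mathcal F\Big]\Big).$$ For $t\in\{0,\dots,T\}$ and $x\in\mathbb R^n$ define the value function $$v_t(x):=\inf_{\pi}\ \mathbb E^\pi\Big[\sum_{s=t}^{T-1}r(x_s,u_s)+q(x_T)\,\Big|\,x_t=x\Big]\quad\text{subject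 to}\quad \mathrm{CVaR}^\pi_\alpha[\mathrm{dist}(x_{s+1},A)\mid\mathcal F_{s-1}]\le\delta\ \text{ a.s.},\quad s=t,\dots,T-1,$$ where the infimum is over all strategies $\pi=(\pi_t,\dots,\pi_{T-1})$, $\pi_s$ being a stochastic kernel from the histories $h_s=(x_t,w_t,\dots,x_{s-1},w_{s-1},x_s)$ to controls with $\pi_s(\mathbb U\mid h_s)=1$; given the past, $u_s$ has law $\pi_s(\cdot\mid h_s)$ and $w_s$ is independent of the past and of $u_s$; $\mathcal F_{s-1}$ is the information available when $w_s$ is about to act, i.e. it is generated by the disturbances before time $s$ and the controls up to and including $u_s$. Values lie in $[-\infty,+\infty]$: $\inf\emptyset=+\infty$, and the expected cost is taken to be $+\infty$ if the positive part of $q(x_T)$ or of some $r(x_s,u_s)$ is not integrable. Suppose that $(x,u)\mapsto f(x,u,w)$ is affine on $\mathbb R^n\times\mathbb U$ for each $w\in\mathbb W$, that $r$ is convex on $\mathbb R^n\times\mathbb U$, and that $q$ is convex on $\mathbb R^n$. Then for every $t\in\{0,1,\dots,T\}$ the value function $v_t:\mathbb R^n\to[-\infty,+\infty]$ is convex, that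 is, its epigraph $\{(x,a)\in\mathbb R^n\times\mathbb R: v_t(x)\le a\}$ is convex. -/

import Mathlib

open MeasureTheory ProbabilityTheory

noncomputable section

namespace SafeControl

/-- The Euclidean space `ℝ^d`. -/
abbrev E (d : ℕ) : Type := EuclideanSpace ℝ (Fin d)

/-- Histories `h_k = (x_0, w_0, …, x_{k-1}, w_{k-1}, x_k)`: the pairs `(x_i, w_i)`, `i < k`,
together with the current state `x_k`. -/
abbrev Hist (n l k : ℕ) : Type := (Fin k → E n × E l) × E n

/-- Sample space: sequences of (control, disturbance) pairs `(u_k, w_k)`. -/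
abbrev Omega (m l : ℕ) : Type := ℕ → E m × E l

/-- A (randomized, history dependent) strategy: at each stage `k` a kernel from histories to
controls. -/
abbrev Strategy (n m l : ℕ) : Type := (k : ℕ) → Kernel (Hist n l k) (E m)

/-- Data and standing assumptions of the risk-constrained stochastic control problem. -/
structure ControlProblem (n m l : ℕ) where
  /-- time horizon -/
  T : ℕ
  /-- dynamics `x_{t+1} = f(x_t, u_t, w_t)` -/
  f : E n → E m → E l → E n
  measurable_f : Measurable fun p : E n × E m × E l => f p.1 p.2.1 p.2.2
  /-- control set -/
  U : Set (E m)
  convex_U : Convex ℝ U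
  measurableSet_U : MeasurableSet U
  /-- disturbance set -/
  W : Set (E l)
  /-- law of the disturbance `w_t`; the disturbances are independent -/
  μ : ℕ → Measure (E l)
  isProbabilityMeasure_μ : ∀ t, IsProbabilityMeasure (μ t)
  mem_W : ∀ t, ∀ᵐ w ∂μ t, w ∈ W
  /-- stage cost -/
  r : E n → E m → ℝ
  measurable_r : Measurable fun p : E n × E m => r p.1 p.2
  /-- terminal cost -/
  q : E n → ℝ
  measurable_q : Measurable q
  /-- safe set -/
  A : Set (E n)
  nonempty_A : A.Nonempty
  isCompact_A : IsCompact A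
  convex_A : Convex ℝ A
  /-- CVaR level -/
  α : ℝ
  α_pos : 0 < α
  α_lt_one : α < 1
  /-- risk tolerance -/
  δ : ℝ
  δ_nonneg : 0 ≤ δ

/-- The objective `Z + E[(X - Z)⁺ / (1 - α) | F]` of the extremal representation of the
conditional CVaR, as an extended-real random variable. -/
def condCVaRObjective {Ω : Type*} (F : MeasurableSpace Ω) {mΩ : MeasurableSpace Ω} (P : Measure Ω)
    (α : ℝ) (X Z : Ω → ℝ) (ω : Ω) : EReal :=
  (Z ω : EReal) +
    ((P⁻[fun ω' => ENNReal.ofReal (max (X ω' - Z ω') 0 / (1 - α)) | F] ω : ENNReal) : EReal)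

/-- `Y` is (a version of) the conditional CVaR
`CVaR_α[X | F] = min_{Z ∈ L²(F)} (Z + E[(X - Z)⁺ / (1 - α) | F])`: the greatest lower bound of
the objectives, over all `Z ∈ L²(F)`, for the almost sure order on `F`-measurable random
variables. -/
structure IsCondCVaR {Ω : Type*} (F : MeasurableSpace Ω) {mΩ : MeasurableSpace Ω} (P : Measure Ω)
    (α : ℝ) (X : Ω → ℝ) (Y : Ω → EReal) : Prop where
  measurable : Measurable[F] Y
  le_objective : ∀ Z : Ω → ℝ, Measurable[F] Z → MemLp Z 2 P →
    ∀ᵐ ω ∂P, Y ω ≤ condCVaRObjective F P α X Z ω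
  greatest : ∀ Y' : Ω → EReal, Measurable[F] Y' →
    (∀ Z : Ω → ℝ, Measurable[F] Z → MemLp Z 2 P →
      ∀ᵐ ω ∂P, Y' ω ≤ condCVaRObjective F P α X Z ω) →
    ∀ᵐ ω ∂P, Y' ω ≤ Y ω

/-- Convexity of an extended-real-valued function: its epigraph is a convex set. -/
def EConvex {V : Type*} [AddCommGroup V] [Module ℝ V] (v : V → EReal) : Prop :=
  Convex ℝ {p : V × ℝ | v p.1 ≤ (p.2 : EReal)}

namespace ControlProblem

variable {n m l : ℕ} (C : ControlProblem n m l)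

/-- State after `k` stages when started from `x` and driven by the controls and disturbances
in `ω`. -/
def state (x : E n) (ω : Omega m l) : ℕ → E n
  | 0 => x
  | k + 1 => C.f (state x ω k) (ω k).1 (ω k).2

/-- History after `k` stages. -/
def hist (x : E n) (ω : Omega m l) (k : ℕ) : Hist n l k :=
  (fun i => (C.state x ω i, (ω i).2), C.state x ω k)

/-- Law of `(u_i, w_i)_{i < k}` (later coordinates are a dummy `0`) induced by the strategy `π`
for the system started at time `t` in state `x`. Given the past, `u_k` has law `π_k(· | h_k)`, and
`w_k` has law `μ_{t+k}` and is independent of the past and of `u_k`. -/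
def law (t : ℕ) (π : Strategy n m l) (x : E n) : ℕ → Measure (Omega m l)
  | 0 => Measure.dirac 0
  | k + 1 => (law t π x k).bind fun ω =>
      ((π k (C.hist x ω k)).prod (C.μ (t + k))).map fun p => Function.update ω k p

/-- Information available when the `k`-th disturbance is about to act: the controls and
disturbances of the stages `i < k`, and the control `u_k` (hence the state and the history at
stage `k`). -/
abbrev info (m l k : ℕ) : MeasurableSpace (Omega m l) :=
  MeasurableSpace.comap (fun ω => ((fun i : Fin k => ω i), (ω k).1)) inferInstance

/-- `π` is an admissible strategy on `N` stages: stochastic kernels concentrated on `U`. -/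
def Admissible (N : ℕ) (π : Strategy n m l) : Prop :=
  ∀ k < N, IsMarkovKernel (π k) ∧ ∀ h, π k h C.U = 1

/-- The safety risk constraints at all `N` stages, started at time `t` in `x`: the conditional
CVaR of the distance of the next state to `A` is almost surely at most `δ`. -/
def RiskConstraint (t N : ℕ) (π : Strategy n m l) (x : E n) : Prop :=
  ∀ k < N, ∃ Y : Omega m l → EReal,
    IsCondCVaR (info m l k) (C.law t π x N) C.α
      (fun ω => Metric.infDist (C.state x ω (k + 1)) C.A) Y ∧
    ∀ᵐ ω ∂C.law t π x N, Y ω ≤ (C.δ : EReal)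

/-- Total cost over `N` stages along a trajectory. -/
def totalCost (N : ℕ) (x : E n) (ω : Omega m l) : ℝ :=
  ∑ k ∈ Finset.range N, C.r (C.state x ω k) (ω k).1 + C.q (C.state x ω N)

open Classical in
/-- Expected total cost in `[-∞, ∞]`, namely `E[c⁺] - E[c⁻]` for the total cost `c`. If the
positive part of a stage cost or of the terminal cost is not integrable, it is `+∞`. -/
def expectedCost (t N : ℕ) (π : Strategy n m l) (x : E n) : EReal :=
  let P := C.law t π x N
  if (∀ k < N, ∫⁻ ω, ENNReal.ofReal (C.r (C.state x ω k) (ω k).1) ∂P ≠ ⊤) ∧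
      ∫⁻ ω, ENNReal.ofReal (C.q (C.state x ω N)) ∂P ≠ ⊤ then
    ((∫⁻ ω, ENNReal.ofReal (C.totalCost N x ω) ∂P : ENNReal) : EReal) -
      ((∫⁻ ω, ENNReal.ofReal (-C.totalCost N x ω) ∂P : ENNReal) : EReal)
  else ⊤

/-- The value function `v_t`: the infimum of the expected cost from time `t` to `T`, started at
time `t` in `x`, over the admissible strategies satisfying the risk constraints (`+∞` if there are
none). -/
def value (t : ℕ) (x : E n) : EReal :=
  ⨅ (π : Strategy n m l) (_ : C.Admissible (C.T - t) π)
    (_ : C.RiskConstraint t (C.T - t) π x), C.expectedCost t (C.T - t) π x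

end ControlProblem

end SafeControl

end

/-!
The proof replaces strategies by the laws they induce on state-control pairs.

Since `w_k` is independent of the information available at stage `k` (`map_observed_disturbance`),
the conditional CVaR of the distance of the next state to `A` is a deterministic function `cvar` of
`(x_k, u_k)`: integrands can be frozen (`condLExp_info`), and constant levels `Z` already realize
the essential infimum (`isCondCVaR_cvar`). Hence both the risk constraint (`riskConstraint_iff`) and
the expected cost (`expectedCost_eq`) depend only on the laws `ν_k` of the pairs `(x_k, u_k)` and on
the law of the final state. These laws form a flow (`IsFlow`): `ν_k` has the law of `x_k` as its
first marginal, and the image of `ν_k ⊗ μ_{t+k}` under the dynamics is the law of `x_{k+1}`.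
Conversely, disintegrating `ν_k` over the state shows that every flow is generated by a strategy
that only looks at the current state (`IsFlow.exists_strategy`). So the value is the infimum of the
cost over flows.

Convexity over flows is a synchronous coupling argument. Given flows from `x` and `x'`, run both
systems with the same disturbances and conditionally independent controls (`exists_coupling`), and
take the law of the convex combination of the two state-control pairs. As the dynamics is affine for
each disturbance, this is a flow from the convex combination of `x` and `x'`; as the distance to `A`
is convex, `{cvar ≤ δ}` is convex among the pairs with control in `U` (`cvar_combo_le`), so the
constraint is inherited; and as `r` and `q` are convex, the cost is at most the convex combination
of the costs (`IsFlow.exists_combo`).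
-/

/-! ### The law of the controlled process -/

namespace SafeControl

namespace ControlProblem

variable {n m l : ℕ} (C : ControlProblem n m l)

instance (t : ℕ) : IsProbabilityMeasure (C.μ t) := C.isProbabilityMeasure_μ t

/-- Measurability of the state for an arbitrary σ-algebra that makes the earlier stages measurable;
it is used for the full product σ-algebra and for `info`. -/
theorem measurable_state_of {Ω : Type*} [MeasurableSpace Ω] (x : E n) {ξ : Ω → Omega m l} {k : ℕ}
    (hξ : ∀ i < k, Measurable fun ω => ξ ω i) : Measurable fun ω => C.state x (ξ ω) k := by
  induction k with
  | zero => exact measurable_const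
  | succ k ih =>
    have h := hξ k k.lt_succ_self
    exact C.measurable_f.comp ((ih fun i hi => hξ i (hi.trans k.lt_succ_self)).prodMk
      (h.fst.prodMk h.snd))

@[fun_prop]
theorem measurable_state (x : E n) (k : ℕ) :
    Measurable fun ω : Omega m l => C.state x ω k :=
  C.measurable_state_of x fun i _ => measurable_pi_apply i

@[fun_prop]
theorem measurable_hist (x : E n) (k : ℕ) :
    Measurable fun ω : Omega m l => C.hist x ω k := by
  unfold hist
  fun_prop

theorem state_congr (x : E n) {ω ω' : Omega m l} {k : ℕ} (h : ∀ i < k, ω i = ω' i) :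
    C.state x ω k = C.state x ω' k := by
  induction k with
  | zero => rfl
  | succ k ih =>
    simp only [state, ih fun i hi => h i (hi.trans k.lt_succ_self), h k k.lt_succ_self]

@[simp]
theorem state_update (x : E n) (ω : Omega m l) {j k : ℕ} (h : k ≤ j) (p : E m × E l) :
    C.state x (Function.update ω j p) k = C.state x ω k :=
  C.state_congr x fun i hi => Function.update_of_ne (by omega) _ _

section Law

variable {t N : ℕ} {π : Strategy n m l} {x : E n}

/-- One step of the law: given the past, the new control has law `π_k(· | h_k)` and the new
disturbance is independent of everything else. -/
theorem lintegral_law_succ {k : ℕ} [IsMarkovKernel (π k)] {h : Omega m l → ENNReal}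
    (hh : Measurable h) :
    ∫⁻ ω, h ω ∂C.law t π x (k + 1) =
      ∫⁻ ω, ∫⁻ u, ∫⁻ w, h (Function.update ω k (u, w)) ∂C.μ (t + k) ∂π k (C.hist x ω k)
        ∂C.law t π x k := by
  have hu : Measurable fun p : Omega m l × (E m × E l) => Function.update p.1 k p.2 := by
    refine measurable_pi_lambda _ fun i => ?_
    by_cases hi : i = k
    · subst hi; simpa using measurable_snd
    · simp only [Function.update_of_ne hi]
      fun_prop
  let κ : Kernel (Omega m l) (Omega m l) :=
    (Kernel.id ×ₖ ((π k).comap _ (C.measurable_hist x k) ×ₖ Kernel.const _ (C.μ (t + k)))).map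
      fun p => Function.update p.1 k p.2
  have hκ : ∀ ω, κ ω =
      ((π k (C.hist x ω k)).prod (C.μ (t + k))).map fun p => Function.update ω k p := by
    intro ω
    simp only [κ]
    rw [Kernel.map_apply _ hu, Kernel.prod_apply, Kernel.id_apply, Kernel.prod_apply,
      Measure.dirac_prod, Measure.map_map hu (by fun_prop)]
    rfl
  rw [law]
  simp_rw [← hκ]
  rw [Measure.lintegral_bind κ.aemeasurable hh.aemeasurable]
  refine lintegral_congr fun ω => ?_
  have hω : Measurable fun p : E m × E l => Function.update ω k p :=
    hu.comp (measurable_const.prodMk measurable_id)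
  rw [hκ, lintegral_map hh hω]
  exact lintegral_prod _ (hh.comp hω).aemeasurable

theorem isProbabilityMeasure_law {N : ℕ} (hπ : ∀ k < N, IsMarkovKernel (π k)) :
    IsProbabilityMeasure (C.law t π x N) := by
  induction N with
  | zero => exact inferInstanceAs (IsProbabilityMeasure (Measure.dirac 0))
  | succ k ih =>
    have := ih fun i hi => hπ i (hi.trans k.lt_succ_self)
    have := hπ k k.lt_succ_self
    constructor
    rw [← lintegral_one, C.lintegral_law_succ measurable_const]
    simp

/-- Functions of the first `k` stages have the same law at every later stage. -/
theorem lintegral_law_of_le {k : ℕ} (hk : k ≤ N) (hπ : ∀ k < N, IsMarkovKernel (π k))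
    {h : Omega m l → ENNReal} (hh : Measurable h)
    (hdep : ∀ ω, ∀ j ≥ k, ∀ p, h (Function.update ω j p) = h ω) :
    ∫⁻ ω, h ω ∂C.law t π x N = ∫⁻ ω, h ω ∂C.law t π x k := by
  induction N, hk using Nat.le_induction with
  | base => rfl
  | succ j hj ih =>
    have := hπ j j.lt_succ_self
    rw [C.lintegral_law_succ hh, ← ih fun i hi => hπ i (hi.trans j.lt_succ_self)]
    simp [hdep _ j hj]

/-- `(u_i, w_i)_{i < k}` and `u_k`, the random variable generating `info m l k`. -/
def observed (m l k : ℕ) (ω : Omega m l) : (Fin k → E m × E l) × E m :=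
  (fun i => ω i, (ω k).1)

@[fun_prop]
theorem measurable_observed (k : ℕ) : Measurable (observed m l k) := by
  unfold observed
  fun_prop

theorem info_le (m l k : ℕ) : info m l k ≤ MeasurableSpace.pi :=
  (measurable_observed k).comap_le

theorem measurable_info_state_control (x : E n) (k : ℕ) :
    Measurable[info m l k] fun ω : Omega m l => (C.state x ω k, (ω k).1) := by
  have h : Measurable[info m l k] (observed m l k) := comap_measurable _
  refine Measurable.prodMk ?_ (measurable_snd.comp h)
  refine @measurable_state_of _ _ _ C _ (info m l k) x id k fun i hi => ?_
  exact ((measurable_pi_apply (⟨i, hi⟩ : Fin k)).comp measurable_fst).comp h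

theorem observed_update_of_lt {j k : ℕ} (h : k < j) (ω : Omega m l) (p : E m × E l) :
    observed m l k (Function.update ω j p) = observed m l k ω := by
  have : ∀ i : Fin k, (i : ℕ) ≠ j := fun i => by omega
  simp [observed, Function.update_of_ne h.ne, this]

theorem observed_update_self (k : ℕ) (ω : Omega m l) (u : E m) (w : E l) :
    observed m l k (Function.update ω k (u, w)) = (fun i : Fin k => ω i, u) := by
  have : ∀ i : Fin k, (i : ℕ) ≠ k := fun i => by omega
  simp [observed, this]

/-- Integration of a function of the information at stage `k` and of the disturbance `w_k`. -/
theorem lintegral_law_observed {k : ℕ} (hk : k < N) (hπ : ∀ k < N, IsMarkovKernel (π k))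
    {h : ((Fin k → E m × E l) × E m) × E l → ENNReal} (hh : Measurable h) :
    ∫⁻ ω, h (observed m l k ω, (ω k).2) ∂C.law t π x N =
      ∫⁻ ω, ∫⁻ u, ∫⁻ w, h ((fun i : Fin k => ω i, u), w) ∂C.μ (t + k) ∂π k (C.hist x ω k)
        ∂C.law t π x k := by
  have := hπ k hk
  have hm : Measurable fun ω : Omega m l => h (observed m l k ω, (ω k).2) := by fun_prop
  rw [C.lintegral_law_of_le (k := k + 1) hk hπ hm, C.lintegral_law_succ hm]
  · simp [observed_update_self]
  · intro ω j hj p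
    rw [observed_update_of_lt hj, Function.update_of_ne (by omega)]

/-- The disturbance `w_k` is independent of the information at stage `k` and has
law `μ_{t+k}`. -/
theorem map_observed_disturbance {k : ℕ} (hk : k < N) (hπ : ∀ k < N, IsMarkovKernel (π k)) :
    (C.law t π x N).map (fun ω => (observed m l k ω, (ω k).2)) =
      ((C.law t π x N).map (observed m l k)).prod (C.μ (t + k)) := by
  have := C.isProbabilityMeasure_law (t := t) (x := x) hπ
  refine Measure.ext_of_lintegral _ fun h hh => ?_
  have hm : Measurable fun g => ∫⁻ w, h (g, w) ∂C.μ (t + k) := hh.lintegral_prod_right'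
  rw [lintegral_map hh (by fun_prop), lintegral_prod _ hh.aemeasurable,
    lintegral_map hm (by fun_prop), C.lintegral_law_observed hk hπ hh,
    C.lintegral_law_observed (h := fun p => ∫⁻ w, h (p.1, w) ∂C.μ (t + k)) hk hπ
      (hm.comp measurable_fst)]
  simp

/-- Fubini form of the independence of `w_k` and the information at stage `k`: the disturbance may
be integrated out first. -/
theorem lintegral_law_independent {k : ℕ} (hk : k < N) (hπ : ∀ k < N, IsMarkovKernel (π k))
    {h : ((Fin k → E m × E l) × E m) × E l → ENNReal} (hh : Measurable h) :
    ∫⁻ ω, h (observed m l k ω, (ω k).2) ∂C.law t π x N =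
      ∫⁻ ω, ∫⁻ w, h (observed m l k ω, w) ∂C.μ (t + k) ∂C.law t π x N := by
  have hm : Measurable fun g => ∫⁻ w, h (g, w) ∂C.μ (t + k) := hh.lintegral_prod_right'
  rw [← lintegral_map hh (by fun_prop), C.map_observed_disturbance hk hπ,
    lintegral_prod _ hh.aemeasurable, lintegral_map hm (by fun_prop)]

/-- The joint law of the state `x_k` and the control `u_k` on `N` stages. -/
noncomputable def occupation (t N : ℕ) (π : Strategy n m l) (x : E n) (k : ℕ) :
    Measure (E n × E m) :=
  (C.law t π x N).map fun ω => (C.state x ω k, (ω k).1)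

/-- The law of the state `x_k` on `N` stages. -/
noncomputable def stateLaw (t N : ℕ) (π : Strategy n m l) (x : E n) (k : ℕ) : Measure (E n) :=
  (C.law t π x N).map fun ω => C.state x ω k

/-- The dynamics, with the state and the control paired. -/
def step (p : (E n × E m) × E l) : E n := C.f p.1.1 p.1.2 p.2

@[fun_prop]
theorem measurable_step : Measurable C.step :=
  C.measurable_f.comp (by fun_prop : Measurable fun p : (E n × E m) × E l => (p.1.1, p.1.2, p.2))

theorem stateLaw_zero (hπ : ∀ k < N, IsMarkovKernel (π k)) :
    C.stateLaw t N π x 0 = Measure.dirac x := by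
  have := C.isProbabilityMeasure_law (t := t) (x := x) hπ
  simp [stateLaw, state, Measure.map_const]

theorem fst_occupation (k : ℕ) : (C.occupation t N π x k).fst = C.stateLaw t N π x k := by
  rw [occupation, stateLaw, Measure.fst, Measure.map_map (by fun_prop) (by fun_prop)]
  rfl

theorem stateLaw_succ {k : ℕ} (hk : k < N) (hπ : ∀ k < N, IsMarkovKernel (π k)) :
    C.stateLaw t N π x (k + 1) =
      ((C.occupation t N π x k).prod (C.μ (t + k))).map C.step := by
  have := C.isProbabilityMeasure_law (t := t) (x := x) hπ
  obtain ⟨g, hg, hgo⟩ := Measurable.exists_eq_measurable_comp (f := observed m l k)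
    (C.measurable_info_state_control x k)
  have hgo' : ∀ ω : Omega m l, (C.state x ω k, (ω k).1) = g (observed m l k ω) :=
    fun ω => congrFun hgo ω
  refine Measure.ext_of_lintegral _ fun h hh => ?_
  have h2 : Measurable fun p : (E n × E m) => ∫⁻ w, h (C.step (p, w)) ∂C.μ (t + k) :=
    Measurable.lintegral_prod_right' (f := fun q => h (C.step q)) (by fun_prop)
  rw [stateLaw, occupation, lintegral_map hh (by fun_prop), lintegral_map hh (by fun_prop),
    lintegral_prod _ (by fun_prop), lintegral_map h2 (by fun_prop)]
  simp_rw [hgo']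
  rw [← C.lintegral_law_independent (h := fun q => h (C.step (g q.1, q.2))) hk hπ (by fun_prop)]
  simp_rw [← hgo']
  rfl

theorem ae_occupation_mem {k : ℕ} (hk : k < N) (hπ : C.Admissible N π) :
    ∀ᵐ p ∂C.occupation t N π x k, p.2 ∈ C.U := by
  have hπ' := fun k hk => (hπ k hk).1
  have := (hπ k hk).1
  rw [occupation, ae_map_iff (by fun_prop) (measurable_snd C.measurableSet_U)]
  -- the probability of `u_k ∉ U` is an integral of `π_k(Uᶜ | h_k) = 0`
  have hm : Measurable fun p : ((Fin k → E m × E l) × E m) × E l =>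
      (C.Uᶜ).indicator (1 : E m → ENNReal) p.1.2 :=
    (measurable_one.indicator C.measurableSet_U.compl).comp (by fun_prop)
  have h0 := C.lintegral_law_observed (t := t) (x := x) hk hπ' hm
  have hU : ∀ h, π k h C.Uᶜ = 0 := fun h =>
    (prob_compl_eq_zero_iff C.measurableSet_U).2 ((hπ k hk).2 h)
  simp only [lintegral_const, measure_univ, mul_one, lintegral_indicator_one
    C.measurableSet_U.compl, hU] at h0
  rw [zero_mul, lintegral_eq_zero_iff (by
    exact hm.comp ((measurable_observed k).prodMk (measurable_pi_apply k).snd))] at h0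
  filter_upwards [h0] with ω hω
  simpa [observed] using hω

/-- For a strategy that uses the current state only, the joint law of state and control is the
composition of the law of the state with the strategy. -/
theorem occupation_markov {K : ℕ → Kernel (E n) (E m)} (hπK : π = fun k =>
    (K k).comap Prod.snd measurable_snd) {k : ℕ} (hk : k < N)
    (hK : ∀ k < N, IsMarkovKernel (K k)) :
    C.occupation t N π x k = C.stateLaw t N π x k ⊗ₘ K k := by
  have hπ : ∀ k < N, IsMarkovKernel (π k) := fun k hk => by
    have := hK k hk; subst hπK; infer_instance
  have := hπ k hk
  have := hK k hk
  have := C.isProbabilityMeasure_law (t := t) (x := x) hπ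
  have : IsProbabilityMeasure (C.stateLaw t N π x k) :=
    Measure.isProbabilityMeasure_map (by fun_prop)
  refine Measure.ext_of_lintegral _ fun h hh => ?_
  have h1 : Measurable fun ω : Omega m l => h (C.state x ω k, (ω k).1) := by fun_prop
  have h2 : Measurable fun y => ∫⁻ u, h (y, u) ∂K k y := hh.lintegral_kernel_prod_right'
  rw [occupation, lintegral_map hh (by fun_prop), Measure.lintegral_compProd hh,
    stateLaw, lintegral_map h2 (by fun_prop),
    C.lintegral_law_of_le (k := k + 1) hk hπ h1, C.lintegral_law_succ h1,
    C.lintegral_law_of_le (k := k) hk.le hπ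
      (h := fun ω => ∫⁻ u, h (C.state x ω k, u) ∂K k (C.state x ω k))
      (h2.comp (C.measurable_state x k))]
  · simp [hπK, hist]
  · intro ω j hj p
    simp only [C.state_update x ω hj]
  · intro ω j hj p
    rw [C.state_update x ω (by omega), Function.update_of_ne (by omega)]

end Law

end ControlProblem

end SafeControl

/-! ### The conditional CVaR of the distance to the safe set -/

namespace SafeControl

namespace ControlProblem

variable {n m l : ℕ} (C : ControlProblem n m l)

/-- Expected normalized excess over the level `z` of the distance to `A` of the successor of the
state-control pair `p` at time `s`. -/
noncomputable def excess (s : ℕ) (p : E n × E m) (z : ℝ) : ENNReal :=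
  ∫⁻ w, ENNReal.ofReal (max (Metric.infDist (C.step (p, w)) C.A - z) 0 / (1 - C.α)) ∂C.μ s

/-- Conditional value at risk of the distance to `A` of the successor of the state-control pair
`p` at time `s`. The infimum is over rational levels, so that it is visibly measurable in `p`; real
levels give the same value by `cvar_le`. -/
noncomputable def cvar (s : ℕ) (p : E n × E m) : EReal :=
  ⨅ z : ℚ, (((z : ℝ) : EReal) + (C.excess s p z : EReal))

theorem measurable_excess_integrand :
    Measurable fun q : ((E n × E m) × ℝ) × E l => ENNReal.ofReal
      (max (Metric.infDist (C.step (q.1.1, q.2)) C.A - q.1.2) 0 / (1 - C.α)) := by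
  have h : Measurable fun q : ((E n × E m) × ℝ) × E l =>
      Metric.infDist (C.step (q.1.1, q.2)) C.A :=
    (Metric.continuous_infDist_pt C.A).measurable.comp (C.measurable_step.comp
      ((measurable_fst.comp measurable_fst).prodMk measurable_snd))
  fun_prop

theorem measurable_excess (s : ℕ) :
    Measurable fun q : (E n × E m) × ℝ => C.excess s q.1 q.2 :=
  C.measurable_excess_integrand.lintegral_prod_right'

theorem measurable_cvar (s : ℕ) : Measurable (C.cvar s) := by
  refine Measurable.iInf fun z => ?_
  have h := (C.measurable_excess s).comp
    (by fun_prop : Measurable fun p : E n × E m => (p, (z : ℝ)))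
  exact measurable_const.add (measurable_coe_ennreal_ereal.comp h)

theorem excess_anti (s : ℕ) (p : E n × E m) : Antitone (C.excess s p) := by
  intro z z' h
  have := C.α_lt_one
  refine lintegral_mono fun w => ENNReal.ofReal_le_ofReal ?_
  have : 0 < 1 - C.α := by linarith
  gcongr

theorem cvar_le (s : ℕ) (p : E n × E m) (z : ℝ) :
    C.cvar s p ≤ (z : EReal) + (C.excess s p z : EReal) := by
  by_cases h : C.excess s p z = ⊤
  · simp [h]
  -- rational levels slightly above `z` do almost as well, as the excess decreases in the level
  by_contra! hlt
  obtain ⟨c, hc1, hc2⟩ := EReal.lt_iff_exists_real_btwn.1 hlt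
  rw [← EReal.coe_toReal (EReal.coe_ennreal_eq_top_iff.not.2 h) (by simp), ← EReal.coe_add,
    EReal.coe_lt_coe_iff] at hc1
  obtain ⟨q, hq1, hq2⟩ := exists_rat_btwn (lt_sub_iff_add_lt.2 hc1)
  refine absurd hc2 (not_lt.2 ((iInf_le _ q).trans ?_))
  calc ((q : ℝ) : EReal) + (C.excess s p q : EReal)
      ≤ ((q : ℝ) : EReal) + (C.excess s p z : EReal) := by
        gcongr
        exact EReal.coe_ennreal_le_coe_ennreal_iff.2 (C.excess_anti s p hq1.le)
    _ ≤ c := by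
        rw [← EReal.coe_toReal (EReal.coe_ennreal_eq_top_iff.not.2 h) (by simp),
          ← EReal.coe_add, EReal.coe_le_coe_iff]
        linarith

section Conditional

variable {t N : ℕ} {π : Strategy n m l} {x : E n}

/-- Freezing lemma: conditionally on the information at stage `k`, the variables known at that
stage are constants and the disturbance `w_k` has law `μ_{t+k}`. -/
theorem condLExp_info {k : ℕ} (hk : k < N) (hπ : ∀ k < N, IsMarkovKernel (π k))
    {V : Type*} [Nonempty V] [MeasurableSpace V] [StandardBorelSpace V] {v : Omega m l → V}
    (hv : Measurable[info m l k] v) {h : V × E l → ENNReal} (hh : Measurable h) :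
    (C.law t π x N)⁻[fun ω => h (v ω, (ω k).2) | info m l k] =ᵐ[C.law t π x N]
      fun ω => ∫⁻ w, h (v ω, w) ∂C.μ (t + k) := by
  have := C.isProbabilityMeasure_law (t := t) (x := x) hπ
  obtain ⟨g, hg, rfl⟩ := Measurable.exists_eq_measurable_comp (f := observed m l k) hv
  symm
  refine ae_eq_condLExp (info_le m l k) _ _ ?_ ?_
  · exact (Measurable.lintegral_prod_right' hh).comp hv
  · rintro s ⟨s', hs', rfl⟩
    have hs : MeasurableSet (observed m l k ⁻¹' s') := measurable_observed k hs'
    change ∫⁻ ω in observed m l k ⁻¹' s', _ ∂_ = ∫⁻ ω in observed m l k ⁻¹' s', _ ∂_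
    rw [← lintegral_indicator hs, ← lintegral_indicator hs]
    have hH : Measurable fun q : ((Fin k → E m × E l) × E m) × E l =>
        s'.indicator (fun _ => (1 : ENNReal)) q.1 * h (g q.1, q.2) :=
      ((measurable_const.indicator hs').comp measurable_fst).mul (by fun_prop)
    have key := C.lintegral_law_independent (t := t) (x := x) hk hπ hH
    calc _ = ∫⁻ ω, ∫⁻ w, s'.indicator (fun _ => (1 : ENNReal)) (observed m l k ω) *
          h (g (observed m l k ω), w) ∂C.μ (t + k) ∂C.law t π x N := by
          refine lintegral_congr fun ω => ?_
          by_cases hω : observed m l k ω ∈ s' <;> simp [Set.indicator, hω]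
      _ = _ := key.symm
      _ = _ := by
          refine lintegral_congr fun ω => ?_
          by_cases hω : observed m l k ω ∈ s' <;> simp [Set.indicator, hω]

theorem condCVaRObjective_ae_eq {k : ℕ} (hk : k < N) (hπ : ∀ k < N, IsMarkovKernel (π k))
    {Z : Omega m l → ℝ} (hZ : Measurable[info m l k] Z) :
    ∀ᵐ ω ∂C.law t π x N, condCVaRObjective (info m l k) (C.law t π x N) C.α
      (fun ω => Metric.infDist (C.state x ω (k + 1)) C.A) Z ω =
      (Z ω : EReal) + (C.excess (t + k) (C.state x ω k, (ω k).1) (Z ω) : EReal) := by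
  have h := C.condLExp_info (t := t) (x := x) hk hπ
    ((C.measurable_info_state_control x k).prodMk hZ) C.measurable_excess_integrand
  filter_upwards [h] with ω hω
  rw [condCVaRObjective]
  congr 2

/-- The conditional CVaR of the distance of the next state to `A` is the function `cvar` of the
current state and control. -/
theorem isCondCVaR_cvar {k : ℕ} (hk : k < N) (hπ : ∀ k < N, IsMarkovKernel (π k)) :
    IsCondCVaR (info m l k) (C.law t π x N) C.α
      (fun ω => Metric.infDist (C.state x ω (k + 1)) C.A)
      (fun ω => C.cvar (t + k) (C.state x ω k, (ω k).1)) where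
  measurable := (C.measurable_cvar _).comp (C.measurable_info_state_control x k)
  le_objective Z hZ _ := by
    filter_upwards [C.condCVaRObjective_ae_eq (t := t) (x := x) hk hπ hZ] with ω hω
    rw [hω]
    exact C.cvar_le _ _ _
  greatest Y' _ hY' := by
    have := C.isProbabilityMeasure_law (t := t) (x := x) hπ
    -- constant levels already realize the infimum
    have h1 : ∀ᵐ ω ∂C.law t π x N, ∀ z : ℚ, Y' ω ≤
        ((z : ℝ) : EReal) + (C.excess (t + k) (C.state x ω k, (ω k).1) z : EReal) := by
      refine ae_all_iff.2 fun z => ?_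
      have hz : Measurable[info m l k] fun _ : Omega m l => (z : ℝ) := measurable_const
      filter_upwards [hY' _ hz (memLp_const _),
        C.condCVaRObjective_ae_eq (t := t) (x := x) hk hπ hz] with ω h1 h2
      rwa [h2] at h1
    filter_upwards [h1] with ω hω
    exact le_iInf hω

/-- The risk constraint only depends on the laws of the state-control pairs. -/
theorem riskConstraint_iff (hπ : ∀ k < N, IsMarkovKernel (π k)) :
    C.RiskConstraint t N π x ↔
      ∀ k < N, ∀ᵐ p ∂C.occupation t N π x k, C.cvar (t + k) p ≤ (C.δ : EReal) := by
  refine forall₂_congr fun k hk => ?_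
  have hm : MeasurableSet {p | C.cvar (t + k) p ≤ (C.δ : EReal)} :=
    measurableSet_le (C.measurable_cvar _) measurable_const
  rw [occupation, ae_map_iff (by fun_prop) hm]
  have hY := C.isCondCVaR_cvar (t := t) (x := x) hk hπ
  constructor
  · rintro ⟨Y, hYc, hYδ⟩
    filter_upwards [hYc.greatest _ hY.measurable hY.le_objective, hYδ] with ω h1 h2
    exact h1.trans h2
  · exact fun h => ⟨_, hY, h⟩

end Conditional

section Convexity

theorem infDist_combo_le {V : Type*} [NormedAddCommGroup V] [NormedSpace ℝ V] {A : Set V}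
    (hA : IsCompact A) (hne : A.Nonempty) (hconv : Convex ℝ A) (y z : V) {a b : ℝ} (ha : 0 ≤ a)
    (hb : 0 ≤ b) (hab : a + b = 1) :
    Metric.infDist (a • y + b • z) A ≤ a * Metric.infDist y A + b * Metric.infDist z A := by
  obtain ⟨y', hy', hy⟩ := hA.exists_infDist_eq_dist hne y
  obtain ⟨z', hz', hz⟩ := hA.exists_infDist_eq_dist hne z
  rw [hy, hz]
  refine (Metric.infDist_le_dist_of_mem (hconv hy' hz' ha hb hab)).trans ?_
  calc dist (a • y + b • z) (a • y' + b • z') ≤ dist (a • y) (a • y') + dist (b • z) (b • z') :=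
        dist_add_add_le _ _ _ _
    _ = a * dist y y' + b * dist z z' := by
        rw [dist_smul₀, dist_smul₀, Real.norm_of_nonneg ha, Real.norm_of_nonneg hb]

variable (hf : ∀ w ∈ C.W, ∃ g : (E n × E m) →ᵃ[ℝ] E n, ∀ x, ∀ u ∈ C.U, C.f x u w = g (x, u))

include hf in
theorem step_combo {p p' : E n × E m} (hp : p.2 ∈ C.U) (hp' : p'.2 ∈ C.U) {a b : ℝ} (ha : 0 ≤ a)
    (hb : 0 ≤ b) (hab : a + b = 1) {w : E l} (hw : w ∈ C.W) :
    C.step (a • p + b • p', w) = a • C.step (p, w) + b • C.step (p', w) := by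
  obtain ⟨g, hg⟩ := hf w hw
  have h : ∀ q : E n × E m, q.2 ∈ C.U → C.step (q, w) = g q := fun q hq => hg q.1 q.2 hq
  rw [h _ (C.convex_U hp hp' ha hb hab), h _ hp, h _ hp', Convex.combo_affine_apply hab]

include hf in
/-- Joint convexity of the expected excess in the state, the control and the level. -/
theorem excess_combo_le (s : ℕ) {p p' : E n × E m} (hp : p.2 ∈ C.U) (hp' : p'.2 ∈ C.U) {a b : ℝ}
    (ha : 0 ≤ a) (hb : 0 ≤ b) (hab : a + b = 1) (z z' : ℝ) :
    C.excess s (a • p + b • p') (a * z + b * z') ≤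
      ENNReal.ofReal a * C.excess s p z + ENNReal.ofReal b * C.excess s p' z' := by
  have hm : ∀ (p : E n × E m) (z : ℝ), Measurable fun w => ENNReal.ofReal
      (max (Metric.infDist (C.step (p, w)) C.A - z) 0 / (1 - C.α)) := by
    intro p z
    have h := C.measurable_excess_integrand.comp
      (by fun_prop : Measurable fun w : E l => ((p, z), w))
    exact h
  have hα : 0 < 1 - C.α := sub_pos.2 C.α_lt_one
  rw [excess, excess, excess, ← lintegral_const_mul _ (hm _ _), ← lintegral_const_mul _ (hm _ _),
    ← lintegral_add_left ((hm _ _).const_mul _)]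
  refine lintegral_mono_ae ?_
  filter_upwards [C.mem_W s] with w hw
  rw [← ENNReal.ofReal_mul ha, ← ENNReal.ofReal_mul hb, ← ENNReal.ofReal_add
    (by positivity) (by positivity), C.step_combo hf hp hp' ha hb hab hw]
  refine ENNReal.ofReal_le_ofReal ?_
  have h := infDist_combo_le C.isCompact_A C.nonempty_A C.convex_A (C.step (p, w))
    (C.step (p', w)) ha hb hab
  set d := Metric.infDist (C.step (p, w)) C.A
  set d' := Metric.infDist (C.step (p', w)) C.A
  rw [mul_div_assoc', mul_div_assoc', ← add_div]
  gcongr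
  refine max_le ?_ (by positivity)
  have h1 : a * (d - z) ≤ a * max (d - z) 0 := by gcongr; exact le_max_left _ _
  have h2 : b * (d' - z') ≤ b * max (d' - z') 0 := by gcongr; exact le_max_left _ _
  linarith

include hf in
/-- The state-control pairs that meet the risk constraint form a convex set. -/
theorem cvar_combo_le (s : ℕ) {p p' : E n × E m} (hp : p.2 ∈ C.U) (hp' : p'.2 ∈ C.U) {a b : ℝ}
    (ha : 0 ≤ a) (hb : 0 ≤ b) (hab : a + b = 1) {c : ℝ} (h : C.cvar s p ≤ c)
    (h' : C.cvar s p' ≤ c) : C.cvar s (a • p + b • p') ≤ c := by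
  -- a nearly optimal level for each pair; their combination is the level used for the mixture
  have level : ∀ {p : E n × E m} {d : ℝ}, C.cvar s p ≤ c → c < d →
      ∃ z : ℝ, C.excess s p z ≠ ⊤ ∧ z + (C.excess s p z).toReal < d := by
    intro p d h hd
    obtain ⟨z, hz⟩ := iInf_lt_iff.1 (h.trans_lt (EReal.coe_lt_coe_iff.2 hd))
    have htop : C.excess s p z ≠ ⊤ := by
      intro htop
      simp [htop] at hz
    refine ⟨z, htop, ?_⟩
    rw [← EReal.coe_toReal (EReal.coe_ennreal_eq_top_iff.not.2 htop) (by simp), ← EReal.coe_add,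
      EReal.coe_lt_coe_iff] at hz
    simpa using hz
  refine EReal.le_of_forall_lt_iff_le.1 fun d hd => ?_
  rw [EReal.coe_lt_coe_iff] at hd
  obtain ⟨z, hz, hzd⟩ := level h hd
  obtain ⟨z', hz', hzd'⟩ := level h' hd
  refine (C.cvar_le s _ (a * z + b * z')).trans ?_
  have key := C.excess_combo_le hf s hp hp' ha hb hab z z'
  rw [← ENNReal.ofReal_toReal hz, ← ENNReal.ofReal_toReal hz', ← ENNReal.ofReal_mul ha,
    ← ENNReal.ofReal_mul hb, ← ENNReal.ofReal_add (by positivity) (by positivity)] at key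
  have key' := EReal.coe_ennreal_le_coe_ennreal_iff.2 key
  rw [EReal.coe_ennreal_ofReal, max_eq_left (by positivity)] at key'
  refine (add_le_add_right key' _).trans ?_
  rw [← EReal.coe_add, EReal.coe_le_coe_iff]
  have h1 := mul_le_mul_of_nonneg_left hzd.le ha
  have h2 := mul_le_mul_of_nonneg_left hzd'.le hb
  have h3 : a * d + b * d = d := by rw [← add_mul, hab, one_mul]
  linarith

end Convexity

end ControlProblem

end SafeControl

/-! ### Integrals with extended real values -/

namespace SafeControl

section ExtendedIntegral

variable {α β : Type*} [MeasurableSpace α] [MeasurableSpace β] {μ : Measure α} {f g : α → ℝ}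

/-- The integral `∫ f⁺ - ∫ f⁻` with values in `[-∞, ∞]`. It is meaningful when `∫ f⁺ < ∞`. -/
noncomputable def eint (μ : Measure α) (f : α → ℝ) : EReal :=
  ((∫⁻ a, ENNReal.ofReal (f a) ∂μ : ENNReal) : EReal) -
    ((∫⁻ a, ENNReal.ofReal (-f a) ∂μ : ENNReal) : EReal)

theorem eint_map {φ : α → β} (hφ : Measurable φ) {f : β → ℝ} (hf : Measurable f) :
    eint (μ.map φ) f = eint μ fun a => f (φ a) := by
  rw [eint, eint, lintegral_map (by fun_prop) hφ, lintegral_map (by fun_prop) hφ]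

theorem eint_mono (h : f ≤ᵐ[μ] g) : eint μ f ≤ eint μ g := by
  refine EReal.sub_le_sub ?_ ?_
  · exact EReal.coe_ennreal_le_coe_ennreal_iff.2
      (lintegral_mono_ae (h.mono fun a ha => ENNReal.ofReal_le_ofReal ha))
  · exact EReal.coe_ennreal_le_coe_ennreal_iff.2
      (lintegral_mono_ae (h.mono fun a ha => ENNReal.ofReal_le_ofReal (neg_le_neg ha)))

theorem lintegral_ofReal_add_ne_top (hf : Measurable f)
    (hft : ∫⁻ a, ENNReal.ofReal (f a) ∂μ ≠ ⊤) (hgt : ∫⁻ a, ENNReal.ofReal (g a) ∂μ ≠ ⊤) :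
    ∫⁻ a, ENNReal.ofReal (f a + g a) ∂μ ≠ ⊤ := by
  refine ne_top_of_le_ne_top (ENNReal.add_ne_top.2 ⟨hft, hgt⟩) ?_
  rw [← lintegral_add_left (by fun_prop)]
  exact lintegral_mono fun a => ENNReal.ofReal_add_le

theorem lintegral_ofReal_const_mul {a : ℝ} (ha : 0 ≤ a) (hf : Measurable f) :
    ∫⁻ ω, ENNReal.ofReal (a * f ω) ∂μ = ENNReal.ofReal a * ∫⁻ ω, ENNReal.ofReal (f ω) ∂μ := by
  rw [← lintegral_const_mul _ (by fun_prop)]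
  simp_rw [ENNReal.ofReal_mul ha]

theorem eint_const_mul {a : ℝ} (ha : 0 ≤ a) (hf : Measurable f) :
    eint μ (fun ω => a * f ω) = (a : EReal) * eint μ f := by
  have h := lintegral_ofReal_const_mul (μ := μ) ha hf.neg
  simp only [Pi.neg_apply, mul_neg] at h
  rw [eint, eint, lintegral_ofReal_const_mul ha hf, h, sub_eq_add_neg, sub_eq_add_neg,
    EReal.left_distrib_of_nonneg_of_ne_top (by exact_mod_cast ha) (EReal.coe_ne_top a),
    mul_neg, EReal.coe_ennreal_mul, EReal.coe_ennreal_mul, EReal.coe_ennreal_ofReal,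
    max_eq_left ha]

theorem eint_add (hf : Measurable f) (hg : Measurable g)
    (hft : ∫⁻ a, ENNReal.ofReal (f a) ∂μ ≠ ⊤) (hgt : ∫⁻ a, ENNReal.ofReal (g a) ∂μ ≠ ⊤) :
    eint μ (fun a => f a + g a) = eint μ f + eint μ g := by
  have hst := lintegral_ofReal_add_ne_top (g := g) hf hft hgt
  -- `(f + g)⁺ + f⁻ + g⁻ = (f + g)⁻ + f⁺ + g⁺`, an identity without subtraction
  have key : ∫⁻ a, ENNReal.ofReal (f a + g a) ∂μ + ∫⁻ a, ENNReal.ofReal (-f a) ∂μ +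
      ∫⁻ a, ENNReal.ofReal (-g a) ∂μ = ∫⁻ a, ENNReal.ofReal (-(f a + g a)) ∂μ +
      ∫⁻ a, ENNReal.ofReal (f a) ∂μ + ∫⁻ a, ENNReal.ofReal (g a) ∂μ := by
    rw [← lintegral_add_left (by fun_prop), ← lintegral_add_left (by fun_prop),
      ← lintegral_add_left (by fun_prop), ← lintegral_add_left (by fun_prop)]
    refine lintegral_congr fun a => ?_
    simp only [ENNReal.ofReal, ← ENNReal.coe_add]
    congr 1
    ext
    simp only [NNReal.coe_add, Real.coe_toNNReal']
    rcases max_cases (f a + g a) 0 with h1 | h1 <;>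
    rcases max_cases (-(f a + g a)) 0 with h2 | h2 <;>
    rcases max_cases (f a) 0 with h3 | h3 <;> rcases max_cases (-f a) 0 with h4 | h4 <;>
    rcases max_cases (g a) 0 with h5 | h5 <;> rcases max_cases (-g a) 0 with h6 | h6 <;> linarith
  simp only [eint]
  generalize ∫⁻ a, ENNReal.ofReal (f a + g a) ∂μ = A at *
  generalize ∫⁻ a, ENNReal.ofReal (-(f a + g a)) ∂μ = A' at *
  generalize ∫⁻ a, ENNReal.ofReal (f a) ∂μ = B at *
  generalize ∫⁻ a, ENNReal.ofReal (-f a) ∂μ = B' at *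
  generalize ∫⁻ a, ENNReal.ofReal (g a) ∂μ = D at *
  generalize ∫⁻ a, ENNReal.ofReal (-g a) ∂μ = D' at *
  lift A to NNReal using hst
  lift B to NNReal using hft
  lift D to NNReal using hgt
  -- an infinite negative part on either side makes both sides equal to `⊥`
  rcases eq_or_ne B' ⊤ with rfl | hB
  · have : A' = ⊤ := by simpa using key.symm
    subst this
    simp [sub_eq_add_neg]
  rcases eq_or_ne D' ⊤ with rfl | hD
  · have : A' = ⊤ := by simpa using key.symm
    subst this
    simp [sub_eq_add_neg]
  lift B' to NNReal using hB
  lift D' to NNReal using hD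
  have hA : A' ≠ ⊤ := by
    rintro rfl
    simp [← ENNReal.coe_add] at key
  lift A' to NNReal using hA
  have key' : (A : ℝ) + B' + D' = A' + B + D := by exact_mod_cast key
  simp only [EReal.coe_nnreal_eq_coe_real, ← EReal.coe_sub, ← EReal.coe_add]
  rw [EReal.coe_eq_coe_iff]
  linarith

theorem lintegral_ofReal_sum_ne_top {f : ℕ → α → ℝ} {N : ℕ} (hf : ∀ k, Measurable (f k))
    (hft : ∀ k < N, ∫⁻ a, ENNReal.ofReal (f k a) ∂μ ≠ ⊤) :
    ∫⁻ a, ENNReal.ofReal (∑ k ∈ Finset.range N, f k a) ∂μ ≠ ⊤ := by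
  induction N with
  | zero => simp
  | succ N ih =>
    simp only [Finset.sum_range_succ]
    exact lintegral_ofReal_add_ne_top (by fun_prop) (ih fun k hk => hft k (by omega))
      (hft N (by omega))

theorem eint_sum {f : ℕ → α → ℝ} {N : ℕ} (hf : ∀ k, Measurable (f k))
    (hft : ∀ k < N, ∫⁻ a, ENNReal.ofReal (f k a) ∂μ ≠ ⊤) :
    eint μ (fun a => ∑ k ∈ Finset.range N, f k a) = ∑ k ∈ Finset.range N, eint μ (f k) := by
  induction N with
  | zero => simp [eint]
  | succ N ih =>
    simp only [Finset.sum_range_succ]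
    rw [eint_add (by fun_prop) (hf N)
      (lintegral_ofReal_sum_ne_top hf fun k hk => hft k (by omega)) (hft N (by omega)),
      ih fun k hk => hft k (by omega)]

end ExtendedIntegral

namespace ControlProblem

variable {n m l : ℕ} (C : ControlProblem n m l)

/-- Positive parts of the costs have finite integrals against the laws `ν k` of the state-control
pairs and the law `ρ` of the final state. -/
def FiniteCost (N : ℕ) (ν : ℕ → Measure (E n × E m)) (ρ : Measure (E n)) : Prop :=
  (∀ k < N, ∫⁻ p, ENNReal.ofReal (C.r p.1 p.2) ∂ν k ≠ ⊤) ∧ ∫⁻ y, ENNReal.ofReal (C.q y) ∂ρ ≠ ⊤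

/-- The cost in terms of the laws `ν k` of the state-control pairs and of the law `ρ` of the final
state. -/
noncomputable def flowCost (N : ℕ) (ν : ℕ → Measure (E n × E m)) (ρ : Measure (E n)) : EReal :=
  ∑ k ∈ Finset.range N, eint (ν k) (fun p => C.r p.1 p.2) + eint ρ C.q

open Classical in
/-- The expected cost only depends on the laws of the state-control pairs and of the final
state. -/
theorem expectedCost_eq (t N : ℕ) (π : Strategy n m l) (x : E n) :
    C.expectedCost t N π x =
      if C.FiniteCost N (C.occupation t N π x) (C.stateLaw t N π x N) then
        C.flowCost N (C.occupation t N π x) (C.stateLaw t N π x N) else ⊤ := by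
  have hr := C.measurable_r
  have hq := C.measurable_q
  have hr' : ∀ k, Measurable fun ω : Omega m l => C.r (C.state x ω k) (ω k).1 := fun k =>
    hr.comp ((C.measurable_state x k).prodMk (measurable_pi_apply k).fst)
  have hq' : Measurable fun ω : Omega m l => C.q (C.state x ω N) :=
    hq.comp (C.measurable_state x N)
  have h1 : ∀ k, ∫⁻ p, ENNReal.ofReal (C.r p.1 p.2) ∂C.occupation t N π x k =
      ∫⁻ ω, ENNReal.ofReal (C.r (C.state x ω k) (ω k).1) ∂C.law t π x N := fun k => by
    rw [occupation, lintegral_map (by fun_prop) (by fun_prop)]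
  have h2 : ∫⁻ y, ENNReal.ofReal (C.q y) ∂C.stateLaw t N π x N =
      ∫⁻ ω, ENNReal.ofReal (C.q (C.state x ω N)) ∂C.law t π x N := by
    rw [stateLaw, lintegral_map (by fun_prop) (by fun_prop)]
  simp only [expectedCost, FiniteCost, h1, h2]
  split_ifs with h
  · change eint _ (C.totalCost N x) = _
    have h3 := eint_add (Finset.measurable_sum (Finset.range N) fun k _ => hr' k) hq'
      (lintegral_ofReal_sum_ne_top hr' h.1) h.2
    rw [eint_sum hr' h.1] at h3
    rw [flowCost, stateLaw, eint_map (by fun_prop) hq]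
    simp_rw [occupation]
    rw [Finset.sum_congr rfl fun k _ => eint_map (μ := C.law t π x N)
      ((C.measurable_state x k).prodMk (measurable_pi_apply k).fst) hr]
    exact h3
  · rfl

end ControlProblem

end SafeControl

/-! ### Flows, couplings and convexity -/

namespace SafeControl

/-- Jensen's inequality for the mixture of the two marginals of a coupling `γ`. -/
theorem eint_map_combo_le {V : Type*} [AddCommGroup V] [Module ℝ V] [MeasurableSpace V]
    [MeasurableAdd₂ V] [MeasurableConstSMul ℝ V] {γ : Measure (V × V)} {f : V → ℝ}
    (hf : Measurable f) {a b : ℝ} (ha : 0 ≤ a) (hb : 0 ≤ b)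
    (h : ∀ᵐ q ∂γ, f (a • q.1 + b • q.2) ≤ a * f q.1 + b * f q.2)
    (h1 : ∫⁻ y, ENNReal.ofReal (f y) ∂γ.fst ≠ ⊤) (h2 : ∫⁻ y, ENNReal.ofReal (f y) ∂γ.snd ≠ ⊤) :
    ∫⁻ y, ENNReal.ofReal (f y) ∂γ.map (fun q => a • q.1 + b • q.2) ≠ ⊤ ∧
      eint (γ.map fun q => a • q.1 + b • q.2) f ≤
        (a : EReal) * eint γ.fst f + (b : EReal) * eint γ.snd f := by
  rw [Measure.fst, lintegral_map (by fun_prop) (by fun_prop)] at h1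
  rw [Measure.snd, lintegral_map (by fun_prop) (by fun_prop)] at h2
  have hm1 : Measurable fun q : V × V => f q.1 := by fun_prop
  have hm2 : Measurable fun q : V × V => f q.2 := by fun_prop
  have h1' : ∫⁻ q, ENNReal.ofReal (a * f q.1) ∂γ ≠ ⊤ := by
    rw [lintegral_ofReal_const_mul ha hm1]
    exact ENNReal.mul_ne_top ENNReal.ofReal_ne_top h1
  have h2' : ∫⁻ q, ENNReal.ofReal (b * f q.2) ∂γ ≠ ⊤ := by
    rw [lintegral_ofReal_const_mul hb hm2]
    exact ENNReal.mul_ne_top ENNReal.ofReal_ne_top h2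
  constructor
  · rw [lintegral_map (by fun_prop) (by fun_prop)]
    refine ne_top_of_le_ne_top (lintegral_ofReal_add_ne_top (by fun_prop) h1' h2') ?_
    exact lintegral_mono_ae (h.mono fun q hq => ENNReal.ofReal_le_ofReal hq)
  · rw [Measure.fst, Measure.snd, eint_map (by fun_prop) hf, eint_map (by fun_prop) hf,
      eint_map (by fun_prop) hf, ← eint_const_mul ha hm1, ← eint_const_mul hb hm2,
      ← eint_add (by fun_prop) (by fun_prop) h1' h2']
    exact eint_mono h

namespace ControlProblem

variable {n m l : ℕ} (C : ControlProblem n m l)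

/-- `ν k`, `k < N`, are laws of state-control pairs and `ρ k`, `k ≤ N`, laws of states that evolve
according to the dynamics from the initial state `x`, satisfy the control constraint and the risk
constraint. -/
structure IsFlow (t N : ℕ) (x : E n) (ν : ℕ → Measure (E n × E m)) (ρ : ℕ → Measure (E n)) :
    Prop where
  isProbabilityMeasure : ∀ k < N, IsProbabilityMeasure (ν k)
  zero : ρ 0 = Measure.dirac x
  fst : ∀ k < N, (ν k).fst = ρ k
  succ : ∀ k < N, ρ (k + 1) = ((ν k).prod (C.μ (t + k))).map C.step
  mem : ∀ k < N, ∀ᵐ p ∂ν k, p.2 ∈ C.U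
  risk : ∀ k < N, ∀ᵐ p ∂ν k, C.cvar (t + k) p ≤ (C.δ : EReal)

theorem isFlow_occupation {t N : ℕ} {π : Strategy n m l} {x : E n} (hπ : C.Admissible N π)
    (hrisk : C.RiskConstraint t N π x) :
    C.IsFlow t N x (C.occupation t N π x) (C.stateLaw t N π x) := by
  have hπ' := fun k hk => (hπ k hk).1
  have := C.isProbabilityMeasure_law (t := t) (x := x) hπ'
  exact
    { isProbabilityMeasure := fun k _ => Measure.isProbabilityMeasure_map (by fun_prop)
      zero := C.stateLaw_zero hπ'
      fst := fun k _ => C.fst_occupation k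
      succ := fun k hk => C.stateLaw_succ hk hπ'
      mem := fun k hk => C.ae_occupation_mem hk hπ
      risk := (C.riskConstraint_iff hπ').1 hrisk }

/-- Disintegration with a kernel that is concentrated on a given set everywhere, not just almost
everywhere. -/
theorem exists_kernel_compProd_eq {α β : Type*} [MeasurableSpace α] [MeasurableSpace β]
    [StandardBorelSpace β] (ν : Measure (α × β)) [IsProbabilityMeasure ν] {U : Set β}
    (hU : MeasurableSet U) (hν : ∀ᵐ p ∂ν, p.2 ∈ U) :
    ∃ K : Kernel α β, IsMarkovKernel K ∧ (∀ y, K y U = 1) ∧ ν = ν.fst ⊗ₘ K := by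
  classical
  obtain ⟨p₀, hp₀⟩ := hν.exists
  have : Nonempty β := ⟨p₀.2⟩
  have hS : MeasurableSet {y | ν.condKernel y U = 1} :=
    ν.condKernel.measurable_coe hU (measurableSet_singleton 1)
  -- on the null set where `condKernel` charges `Uᶜ`, use a point mass in `U` instead
  refine ⟨Kernel.piecewise hS ν.condKernel (Kernel.const _ (Measure.dirac p₀.2)),
    inferInstance, fun y => ?_, ?_⟩
  · by_cases hy : ν.condKernel y U = 1
    · rw [Kernel.piecewise_apply]
      simp [hy]
    · rw [Kernel.piecewise_apply]
      simp [hy, hp₀]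
  · rw [← ν.disintegrate ν.condKernel] at hν
    have h := Measure.ae_ae_of_ae_compProd hν
    have h' : ν.condKernel =ᵐ[ν.fst]
        Kernel.piecewise hS ν.condKernel (Kernel.const _ (Measure.dirac p₀.2)) := by
      filter_upwards [h] with y hy
      have hy1 : ν.condKernel y U = 1 := (mem_ae_iff_prob_eq_one hU).1 hy
      rw [Kernel.piecewise_apply]
      simp [hy1]
    rw [← Measure.compProd_congr h', ν.disintegrate ν.condKernel]

variable {C} {t N : ℕ} {x x' : E n} {ν ν' : ℕ → Measure (E n × E m)} {ρ ρ' : ℕ → Measure (E n)}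

theorem IsFlow.exists_kernel (h : C.IsFlow t N x ν ρ) :
    ∃ K : ℕ → Kernel (E n) (E m), (∀ k, IsMarkovKernel (K k)) ∧
      ∀ k < N, (∀ y, K k y C.U = 1) ∧ ν k = ρ k ⊗ₘ K k := by
  have : ∀ k, ∃ K : Kernel (E n) (E m), IsMarkovKernel K ∧
      (k < N → (∀ y, K y C.U = 1) ∧ ν k = ρ k ⊗ₘ K) := by
    intro k
    by_cases hk : k < N
    · have := h.isProbabilityMeasure k hk
      obtain ⟨K, hK, hKU, hνK⟩ := exists_kernel_compProd_eq (ν k) C.measurableSet_U (h.mem k hk)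
      exact ⟨K, hK, fun _ => ⟨hKU, by rw [← h.fst k hk]; exact hνK⟩⟩
    · exact ⟨Kernel.const _ (Measure.dirac 0), inferInstance, fun hk' => absurd hk' hk⟩
  choose K hK hK' using this
  exact ⟨K, hK, hK'⟩

/-- Every flow is generated by a strategy that uses the current state only. -/
theorem IsFlow.exists_strategy (h : C.IsFlow t N x ν ρ) :
    ∃ π : Strategy n m l, C.Admissible N π ∧ C.RiskConstraint t N π x ∧
      (∀ k < N, C.occupation t N π x k = ν k) ∧ ∀ k ≤ N, C.stateLaw t N π x k = ρ k := by
  obtain ⟨K, hK, hK'⟩ := h.exists_kernel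
  let π : Strategy n m l := fun k => (K k).comap Prod.snd measurable_snd
  have hπ : ∀ k < N, IsMarkovKernel (π k) := fun k _ => inferInstance
  have hocc : ∀ k < N, C.stateLaw t N π x k = ρ k → C.occupation t N π x k = ν k := by
    intro k hk hs
    rw [C.occupation_markov rfl hk fun k _ => hK k, hs, ← (hK' k hk).2]
  have hst : ∀ k ≤ N, C.stateLaw t N π x k = ρ k := by
    intro k hk
    induction k with
    | zero => rw [C.stateLaw_zero hπ, h.zero]
    | succ k ih =>
      rw [C.stateLaw_succ hk hπ, hocc k hk (ih (Nat.le_of_succ_le hk)), ← h.succ k hk]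
  have hocc' : ∀ k < N, C.occupation t N π x k = ν k := fun k hk => hocc k hk (hst k hk.le)
  refine ⟨π, fun k hk => ⟨hπ k hk, fun y => (hK' k hk).1 _⟩,
    (C.riskConstraint_iff hπ).2 fun k hk => ?_, hocc', hst⟩
  rw [hocc' k hk]
  exact h.risk k hk

section Coupling

/-- Law of two state-control pairs, given the law `κ` of the two states, when the controls are
chosen conditionally independently according to `K` and `K'`. -/
noncomputable def pairLaw (κ : Measure (E n × E n)) (K K' : Kernel (E n) (E m)) :
    Measure ((E n × E m) × (E n × E m)) :=
  (κ ⊗ₘ (K.comap Prod.fst measurable_fst ×ₖ K'.comap Prod.snd measurable_snd)).map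
    fun q => ((q.1.1, q.2.1), (q.1.2, q.2.2))

instance (κ : Measure (E n × E n)) [IsProbabilityMeasure κ] (K K' : Kernel (E n) (E m))
    [IsMarkovKernel K] [IsMarkovKernel K'] : IsProbabilityMeasure (pairLaw κ K K') :=
  Measure.isProbabilityMeasure_map (by fun_prop)

theorem fst_pairLaw (κ : Measure (E n × E n)) [IsProbabilityMeasure κ] (K K' : Kernel (E n) (E m))
    [IsMarkovKernel K] [IsMarkovKernel K'] : (pairLaw κ K K').fst = κ.fst ⊗ₘ K := by
  refine Measure.ext_of_lintegral _ fun h hh => ?_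
  have h2 : Measurable fun y => ∫⁻ u, h (y, u) ∂K y := hh.lintegral_kernel_prod_right'
  rw [Measure.lintegral_compProd hh, pairLaw, Measure.fst, Measure.fst,
    lintegral_map hh (by fun_prop), lintegral_map (by fun_prop) (by fun_prop),
    Measure.lintegral_compProd (by fun_prop), lintegral_map h2 (by fun_prop)]
  refine lintegral_congr fun y => ?_
  rw [Kernel.prod_apply, lintegral_prod _ (by fun_prop)]
  simp

theorem snd_pairLaw (κ : Measure (E n × E n)) [IsProbabilityMeasure κ] (K K' : Kernel (E n) (E m))
    [IsMarkovKernel K] [IsMarkovKernel K'] : (pairLaw κ K K').snd = κ.snd ⊗ₘ K' := by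
  refine Measure.ext_of_lintegral _ fun h hh => ?_
  have h2 : Measurable fun y => ∫⁻ u, h (y, u) ∂K' y := hh.lintegral_kernel_prod_right'
  rw [Measure.lintegral_compProd hh, pairLaw, Measure.snd, Measure.snd,
    lintegral_map hh (by fun_prop), lintegral_map (by fun_prop) (by fun_prop),
    Measure.lintegral_compProd (by fun_prop), lintegral_map h2 (by fun_prop)]
  refine lintegral_congr fun y => ?_
  rw [Kernel.prod_apply, lintegral_prod _ (by fun_prop)]
  simp

variable (C) in
/-- Successors of two state-control pairs under a common disturbance. -/
def pairStep (q : ((E n × E m) × (E n × E m)) × E l) : E n × E n :=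
  (C.step (q.1.1, q.2), C.step (q.1.2, q.2))

@[fun_prop]
theorem measurable_pairStep : Measurable C.pairStep := by
  unfold pairStep
  fun_prop

variable (C) in
/-- Synchronous coupling: joint law of the states of two systems that start in `x` and `x'`, use
the strategies `K` and `K'` and are driven by the same disturbances. -/
noncomputable def coupling (t : ℕ) (x x' : E n) (K K' : ℕ → Kernel (E n) (E m)) :
    ℕ → Measure (E n × E n)
  | 0 => Measure.dirac (x, x')
  | k + 1 => ((pairLaw (coupling t x x' K K' k) (K k) (K' k)).prod (C.μ (t + k))).map C.pairStep

instance (t : ℕ) (x x' : E n) (K K' : ℕ → Kernel (E n) (E m)) [∀ k, IsMarkovKernel (K k)]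
    [∀ k, IsMarkovKernel (K' k)] (k : ℕ) : IsProbabilityMeasure (C.coupling t x x' K K' k) := by
  induction k with
  | zero => exact inferInstanceAs (IsProbabilityMeasure (Measure.dirac (x, x')))
  | succ k ih => exact Measure.isProbabilityMeasure_map (by fun_prop)

theorem fst_map_pairStep (γ : Measure ((E n × E m) × (E n × E m))) [IsProbabilityMeasure γ]
    (s : ℕ) : ((γ.prod (C.μ s)).map C.pairStep).fst = (γ.fst.prod (C.μ s)).map C.step := by
  have : γ.fst.prod (C.μ s) = (γ.prod (C.μ s)).map (Prod.map Prod.fst id) := by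
    rw [← Measure.map_prod_map _ _ measurable_fst measurable_id, Measure.map_id, Measure.fst]
  rw [this, Measure.fst, Measure.map_map (by fun_prop) (by fun_prop),
    Measure.map_map (by fun_prop) (by fun_prop)]
  rfl

theorem snd_map_pairStep (γ : Measure ((E n × E m) × (E n × E m))) [IsProbabilityMeasure γ]
    (s : ℕ) : ((γ.prod (C.μ s)).map C.pairStep).snd = (γ.snd.prod (C.μ s)).map C.step := by
  have : γ.snd.prod (C.μ s) = (γ.prod (C.μ s)).map (Prod.map Prod.snd id) := by
    rw [← Measure.map_prod_map _ _ measurable_snd measurable_id, Measure.map_id, Measure.snd]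
  rw [this, Measure.snd, Measure.map_map (by fun_prop) (by fun_prop),
    Measure.map_map (by fun_prop) (by fun_prop)]
  rfl

/-- The synchronous coupling of two flows has these flows as marginals. -/
theorem exists_coupling (h : C.IsFlow t N x ν ρ) (h' : C.IsFlow t N x' ν' ρ') :
    ∃ (γ : ℕ → Measure ((E n × E m) × (E n × E m))) (κ : ℕ → Measure (E n × E n)),
      (∀ k, IsProbabilityMeasure (γ k)) ∧ κ 0 = Measure.dirac (x, x') ∧
      (∀ k, (γ k).map (fun q => (q.1.1, q.2.1)) = κ k) ∧
      (∀ k, κ (k + 1) = ((γ k).prod (C.μ (t + k))).map C.pairStep) ∧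
      (∀ k < N, (γ k).fst = ν k ∧ (γ k).snd = ν' k) ∧
      ∀ k ≤ N, (κ k).fst = ρ k ∧ (κ k).snd = ρ' k := by
  obtain ⟨K, hK, hνK⟩ := h.exists_kernel
  obtain ⟨K', hK', hνK'⟩ := h'.exists_kernel
  let κ := C.coupling t x x' K K'
  let γ := fun k => pairLaw (κ k) (K k) (K' k)
  have hγ : ∀ k < N, (κ k).fst = ρ k ∧ (κ k).snd = ρ' k → (γ k).fst = ν k ∧ (γ k).snd = ν' k := by
    intro k hk hκ
    rw [fst_pairLaw, snd_pairLaw, hκ.1, hκ.2, ← (hνK k hk).2, ← (hνK' k hk).2]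
    exact ⟨rfl, rfl⟩
  have hκ : ∀ k ≤ N, (κ k).fst = ρ k ∧ (κ k).snd = ρ' k := by
    intro k hk
    induction k with
    | zero =>
      rw [h.zero, h'.zero]
      change (Measure.dirac (x, x')).fst = _ ∧ (Measure.dirac (x, x')).snd = _
      simp [Measure.fst, Measure.snd, measurable_fst, measurable_snd]
    | succ k ih =>
      have hk' := hγ k hk (ih (Nat.le_of_succ_le hk))
      rw [h.succ k hk, h'.succ k hk, ← hk'.1, ← hk'.2]
      exact ⟨fst_map_pairStep _ _, snd_map_pairStep _ _⟩
  refine ⟨γ, κ, fun k => inferInstance, rfl, fun k => ?_, fun k => rfl,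
    fun k hk => hγ k hk (hκ k hk.le), hκ⟩
  change (pairLaw _ _ _).map _ = _
  rw [pairLaw, Measure.map_map (by fun_prop) (by fun_prop)]
  exact Measure.fst_compProd _ _

end Coupling

section Convexity

variable (hf : ∀ w ∈ C.W, ∃ g : (E n × E m) →ᵃ[ℝ] E n, ∀ x, ∀ u ∈ C.U, C.f x u w = g (x, u))
  (hr : ConvexOn ℝ (Set.univ ×ˢ C.U) (fun p : E n × E m => C.r p.1 p.2))
  (hq : ConvexOn ℝ Set.univ C.q)

include hf hr hq in
/-- Mixing two flows through their synchronous coupling: the convex combination of the coupled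
state-control pairs is a flow from the convex combination of the initial states, and its cost is
at most the convex combination of the costs. -/
theorem IsFlow.exists_combo (h : C.IsFlow t N x ν ρ) (h' : C.IsFlow t N x' ν' ρ')
    (hfin : C.FiniteCost N ν (ρ N)) (hfin' : C.FiniteCost N ν' (ρ' N)) {a b : ℝ} (ha : 0 ≤ a)
    (hb : 0 ≤ b) (hab : a + b = 1) :
    ∃ (ν₁ : ℕ → Measure (E n × E m)) (ρ₁ : ℕ → Measure (E n)),
      C.IsFlow t N (a • x + b • x') ν₁ ρ₁ ∧ C.FiniteCost N ν₁ (ρ₁ N) ∧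
      C.flowCost N ν₁ (ρ₁ N) ≤
        (a : EReal) * C.flowCost N ν (ρ N) + (b : EReal) * C.flowCost N ν' (ρ' N) := by
  obtain ⟨γ, κ, hγ, hκ0, hκγ, hκs, hγν, hκρ⟩ := exists_coupling h h'
  have hU : ∀ k < N, ∀ᵐ q ∂γ k, q.1.2 ∈ C.U ∧ q.2.2 ∈ C.U := by
    intro k hk
    have h1 := h.mem k hk
    have h2 := h'.mem k hk
    rw [← (hγν k hk).1] at h1
    rw [← (hγν k hk).2] at h2
    filter_upwards [ae_of_ae_map (by fun_prop) h1, ae_of_ae_map (by fun_prop) h2] with q hq1 hq2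
    exact ⟨hq1, hq2⟩
  have hstage : ∀ k < N, _ := fun k hk =>
    eint_map_combo_le (γ := γ k) C.measurable_r ha hb
      ((hU k hk).mono fun q hq => hr.2 ⟨trivial, hq.1⟩ ⟨trivial, hq.2⟩ ha hb hab)
      (by rw [(hγν k hk).1]; exact hfin.1 k hk) (by rw [(hγν k hk).2]; exact hfin'.1 k hk)
  have hlast := eint_map_combo_le (γ := κ N) C.measurable_q ha hb
      (.of_forall fun q => hq.2 trivial trivial ha hb hab)
      (by rw [(hκρ N le_rfl).1]; exact hfin.2) (by rw [(hκρ N le_rfl).2]; exact hfin'.2)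
  refine ⟨fun k => (γ k).map fun q => a • q.1 + b • q.2,
    fun k => (κ k).map fun q => a • q.1 + b • q.2, ?_, ?_, ?_⟩
  · -- a combination of successors is the successor of the combination, since `f(·, ·, w)` is affine
    refine ⟨fun k _ => Measure.isProbabilityMeasure_map (by fun_prop), ?_, fun k _ => ?_,
      fun k hk => ?_, fun k hk => ?_, fun k hk => ?_⟩
    · simp only [hκ0]
      rw [Measure.map_dirac' (by fun_prop)]
    · rw [← hκγ k, Measure.fst, Measure.map_map (by fun_prop) (by fun_prop),
        Measure.map_map (by fun_prop) (by fun_prop)]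
      rfl
    · have hprod : ((γ k).map fun q => a • q.1 + b • q.2).prod (C.μ (t + k)) =
          ((γ k).prod (C.μ (t + k))).map (Prod.map (fun q => a • q.1 + b • q.2) id) := by
        rw [← Measure.map_prod_map _ _ (by fun_prop) measurable_id, Measure.map_id]
      rw [hκs k, hprod, Measure.map_map (by fun_prop) (by fun_prop),
        Measure.map_map (by fun_prop) (by fun_prop)]
      refine Measure.map_congr ?_
      filter_upwards [Measure.quasiMeasurePreserving_fst.ae (hU k hk),
        Measure.quasiMeasurePreserving_snd.ae (C.mem_W (t + k))] with q hq hw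
      exact (C.step_combo hf hq.1 hq.2 ha hb hab hw).symm
    · rw [ae_map_iff (by fun_prop) (measurable_snd C.measurableSet_U)]
      filter_upwards [hU k hk] with q hq
      exact C.convex_U hq.1 hq.2 ha hb hab
    · rw [ae_map_iff (by fun_prop) (measurableSet_le (C.measurable_cvar _) measurable_const)]
      have h1 := h.risk k hk
      have h2 := h'.risk k hk
      rw [← (hγν k hk).1] at h1
      rw [← (hγν k hk).2] at h2
      filter_upwards [hU k hk, ae_of_ae_map (by fun_prop) h1,
        ae_of_ae_map (by fun_prop) h2] with q hq hq1 hq2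
      exact C.cvar_combo_le hf _ hq.1 hq.2 ha hb hab hq1 hq2
  · exact ⟨fun k hk => (hstage k hk).1, hlast.1⟩
  · have ha' : (0 : EReal) ≤ a := by exact_mod_cast ha
    have hb' : (0 : EReal) ≤ b := by exact_mod_cast hb
    have hdist : ∀ (c : ℝ), 0 ≤ c → ∀ F : ℕ → EReal, (c : EReal) * ∑ k ∈ Finset.range N, F k =
        ∑ k ∈ Finset.range N, (c : EReal) * F k := fun c hc F =>
      map_sum (⟨⟨fun y => (c : EReal) * y, mul_zero _⟩, fun y z =>
        EReal.left_distrib_of_nonneg_of_ne_top (by exact_mod_cast hc) (EReal.coe_ne_top c) y z⟩ :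
        EReal →+ EReal) F _
    simp only [flowCost]
    rw [EReal.left_distrib_of_nonneg_of_ne_top ha' (EReal.coe_ne_top a),
      EReal.left_distrib_of_nonneg_of_ne_top hb' (EReal.coe_ne_top b), hdist a ha, hdist b hb,
      add_add_add_comm, ← Finset.sum_add_distrib]
    refine add_le_add (Finset.sum_le_sum fun k hk => ?_) ?_
    · have hk := Finset.mem_range.1 hk
      rw [← (hγν k hk).1, ← (hγν k hk).2]
      exact (hstage k hk).2
    · rw [← (hκρ N le_rfl).1, ← (hκρ N le_rfl).2]
      exact hlast.2

/-- A strict upper bound of the value is a strict upper bound of the cost of some flow. -/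
theorem exists_isFlow_of_value_lt {c : EReal} (hc : C.value t x < c) :
    ∃ ν ρ, C.IsFlow t (C.T - t) x ν ρ ∧ C.FiniteCost (C.T - t) ν (ρ (C.T - t)) ∧
      C.flowCost (C.T - t) ν (ρ (C.T - t)) < c := by
  simp only [value, iInf_lt_iff] at hc
  obtain ⟨π, hπ, hrisk, hlt⟩ := hc
  rw [expectedCost_eq] at hlt
  split_ifs at hlt with hfin
  · exact ⟨_, _, C.isFlow_occupation hπ hrisk, hfin, hlt⟩
  · exact absurd hlt not_top_lt

theorem IsFlow.value_le (h : C.IsFlow t (C.T - t) x ν ρ)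
    (hfin : C.FiniteCost (C.T - t) ν (ρ (C.T - t))) :
    C.value t x ≤ C.flowCost (C.T - t) ν (ρ (C.T - t)) := by
  obtain ⟨π, hπ, hrisk, hocc, hst⟩ := h.exists_strategy
  refine (iInf_le_of_le π (iInf_le_of_le hπ (iInf_le _ hrisk))).trans ?_
  rw [expectedCost_eq, hst _ le_rfl]
  have h1 : C.FiniteCost (C.T - t) (C.occupation t (C.T - t) π x) (ρ (C.T - t)) :=
    ⟨fun k hk => by rw [hocc k hk]; exact hfin.1 k hk, hfin.2⟩
  rw [if_pos h1, flowCost, flowCost]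
  refine le_of_eq ?_
  congr 1
  exact Finset.sum_congr rfl fun k hk => by rw [hocc k (Finset.mem_range.1 hk)]

end Convexity

end ControlProblem

end SafeControl

theorem proposition1 {n m l : ℕ} (C : SafeControl.ControlProblem n m l)
    (hf : ∀ w ∈ C.W, ∃ g : (SafeControl.E n × SafeControl.E m) →ᵃ[ℝ] SafeControl.E n,
      ∀ x, ∀ u ∈ C.U, C.f x u w = g (x, u))
    (hr : ConvexOn ℝ (Set.univ ×ˢ C.U)
      (fun p : SafeControl.E n × SafeControl.E m => C.r p.1 p.2))
    (hq : ConvexOn ℝ Set.univ C.q) :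
    ∀ t ≤ C.T, SafeControl.EConvex (C.value t) := by
  rintro t - ⟨x, c⟩ hx ⟨x', c'⟩ hx' a b ha hb hab
  change C.value t x ≤ (c : EReal) at hx
  change C.value t x' ≤ (c' : EReal) at hx'
  change C.value t (a • x + b • x') ≤ ((a * c + b * c' : ℝ) : EReal)
  refine EReal.le_of_forall_lt_iff_le.1 fun d hd => ?_
  rw [EReal.coe_lt_coe_iff] at hd
  have hε : 0 < d - (a * c + b * c') := sub_pos.2 hd
  set ε := d - (a * c + b * c')
  have hlt : ∀ r : ℝ, (r : EReal) < ((r + ε : ℝ) : EReal) := fun r =>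
    EReal.coe_lt_coe_iff.2 (lt_add_of_pos_right r hε)
  obtain ⟨ν, ρ, hflow, hfin, hcost⟩ :=
    SafeControl.ControlProblem.exists_isFlow_of_value_lt (hx.trans_lt (hlt c))
  obtain ⟨ν', ρ', hflow', hfin', hcost'⟩ :=
    SafeControl.ControlProblem.exists_isFlow_of_value_lt (hx'.trans_lt (hlt c'))
  obtain ⟨ν₁, ρ₁, hflow₁, hfin₁, hcost₁⟩ :=
    hflow.exists_combo hf hr hq hflow' hfin hfin' ha hb hab
  have ha' : (0 : EReal) ≤ a := by exact_mod_cast ha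
  have hb' : (0 : EReal) ≤ b := by exact_mod_cast hb
  calc C.value t (a • x + b • x') ≤ _ := hflow₁.value_le hfin₁
    _ ≤ _ := hcost₁
    _ ≤ (a : EReal) * ((c + ε : ℝ) : EReal) + (b : EReal) * ((c' + ε : ℝ) : EReal) :=
        add_le_add (mul_le_mul_of_nonneg_left hcost.le ha')
          (mul_le_mul_of_nonneg_left hcost'.le hb')
    _ = ((a * (c + ε) + b * (c' + ε) : ℝ) : EReal) := by push_cast; rfl
    _ = d := by
        congr 1
        calc a * (c + ε) + b * (c' + ε) = a * c + b * c' + (a + b) * ε := by ring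
          _ = d := by rw [hab]; ring
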